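/- For $n\ge 0$ let $\mathscr I_n$ be the set of permutations $\sigma\in S_n$ with $\sigma^2=1$, let $\mathrm{ris}(\sigma)=\#\{i: 1\le i<n,\ \sigma(i)<\sigma(i+1)\}$, and let the integers $f_{n,k}$ be defined by $$\sum_{\sigma\in\mathscr I_n}\mathrm{sgn}(\sigma)\,t^{\mathrm{ris}(\sigma)}=\sum_{k\ge 0}f_{n,k}t^k .$$ A generalized involution of length $n$ over $[s]=\{1,\dots,s\}$ is a biword $\binom{x_1\cdots x_n}{y_1\cdots y_n}$ with letters in $[s]$ such that $x_i\le x_{i+1}$; $x_i=x_{i+1}$ implies $y_i\ge y_{i+1}$; and for all $a,b\in[s]$ the biletter $\binom ab$ occurs exactly as many times as $\binom ba$. Its polarization is the permutation $i\mapsto y_i'$ of $\{1,\dots,n\}$, where $y'_i$ is the rank of $y_i$ among $y_1,\dots,y_n$, with the convention that of two equal letters the one further to the right counts as the smaller. For $\sigma\in\mathscr I_n$ let $\mathrm{Gen}_s(\sigma)$ be the set of generalized involutions of length $n$ over $[s]$ with polarization $\sigma$, and let $\hat a_{n,s}$ be the number of generalized involutions of length $n$ over $[s]$ whose polarization is even,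 minus the number of those whose polarization is odd. Then for all integers $n,s\ge 0$ with $(n,s)\ne(0,0)$, $$\sum_{j=0}^{s-1}\binom{n+j}{j}f_{n,s-j-1}=\sum_{j=0}^{\lfloor n/2\rfloor}(-1)^j\binom{\binom{s+1}{2}+j-1}{j}\binom{s}{n-2j},$$ where $\binom{-1}{0}=1$. Moreover, the left-hand side equals $\hat a_{n,s}$ and also equals $\sum_{\sigma\in\mathscr I_n}\mathrm{sgn}(\sigma)\,|\mathrm{Gen}_s(\sigma)|$; the weights are given, for each $\sigma\in\mathscr I_n$, by $|\mathrm{Gen}_s(\sigma)|=\binom{n+j}{j}$ if $\mathrm{ris}(\sigma)=s-j-1$ with $0\le j<s$, and $|\mathrm{Gen}_s(\sigma)|=0$ if $\mathrm{ris}(\sigma)\ge s$. -/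

import Mathlib

namespace SignedEulerian

/-- The set of involutions of an `n`-element chain (the identity included). -/
def involutions (n : ℕ) : Finset (Equiv.Perm (Fin n)) :=
  Finset.univ.filter fun σ => σ * σ = 1

/-- The number of rises of `σ`: positions `i` with `σ(i) < σ(i+1)`. -/
def ris {n : ℕ} (σ : Equiv.Perm (Fin n)) : ℕ :=
  (Finset.univ.filter fun i : Fin n => ∃ h : i.val + 1 < n, σ i < σ ⟨i.val + 1, h⟩).card

/-- The signed Eulerian polynomial on involutions, `∑ sgn(σ) t ^ ris(σ)`. -/
noncomputable def F (n : ℕ) : Polynomial ℤ :=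
  ∑ σ ∈ involutions n,
    Polynomial.C ((Equiv.Perm.sign σ : ℤˣ) : ℤ) * Polynomial.X ^ ris σ

/-- The signed Eulerian numbers on involutions: the coefficients of `F n`. -/
noncomputable def f (n k : ℕ) : ℤ := (F n).coeff k

/-- The biword with top row `x` and bottom row `y` over an `m`-letter alphabet is a generalized
involution: the top row is weakly increasing, below a block of equal top letters the bottom row is
weakly decreasing, and every biletter `(a, b)` occurs exactly as often as `(b, a)`. -/
def IsGenInvolution {n m : ℕ} (x y : Fin n → Fin m) : Prop :=
  (∀ i j, i ≤ j → x i ≤ x j) ∧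
  (∀ i j, i ≤ j → x i = x j → y j ≤ y i) ∧
  ∀ a b : Fin m, (Finset.univ.filter fun i => x i = a ∧ y i = b).card =
    (Finset.univ.filter fun i => x i = b ∧ y i = a).card

instance {n m : ℕ} (x y : Fin n → Fin m) : Decidable (IsGenInvolution x y) := by
  unfold IsGenInvolution
  infer_instance

/-- The positions of `y` whose letter precedes the letter at position `i`: a smaller letter, or
the same letter further to the right. -/
def preceding {n m : ℕ} (y : Fin n → Fin m) (i : Fin n) : Finset (Fin n) :=
  Finset.univ.filter fun j => y j < y i ∨ (y j = y i ∧ i < j)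

theorem self_notMem_preceding {n m : ℕ} (y : Fin n → Fin m) (i : Fin n) :
    i ∉ preceding y i := by
  simp [preceding]

theorem card_preceding_lt {n m : ℕ} (y : Fin n → Fin m) (i : Fin n) :
    (preceding y i).card < n := by
  have h : (preceding y i).card < (Finset.univ : Finset (Fin n)).card :=
    Finset.card_lt_card (Finset.ssubset_univ_iff.2 fun h =>
      self_notMem_preceding y i (h ▸ Finset.mem_univ i))
  simpa using h

theorem card_preceding_lt_card {n m : ℕ} (y : Fin n → Fin m) {i j : Fin n}
    (h : i ∈ preceding y j) : (preceding y i).card < (preceding y j).card := by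
  apply Finset.card_lt_card
  refine (Finset.ssubset_iff_of_subset ?_).2 ⟨i, h, self_notMem_preceding y i⟩
  intro k hk
  simp only [preceding, Finset.mem_filter, Finset.mem_univ, true_and] at h hk ⊢
  rcases hk with hk | ⟨hk, hk'⟩ <;> rcases h with h | ⟨h, h'⟩
  · exact Or.inl (hk.trans h)
  · exact Or.inl (h ▸ hk)
  · exact Or.inl (hk ▸ h)
  · exact Or.inr ⟨hk.trans h, h'.trans hk'⟩

theorem rank_injective {n m : ℕ} (y : Fin n → Fin m) :
    Function.Injective fun i : Fin n =>
      (⟨(preceding y i).card, card_preceding_lt y i⟩ : Fin n) := by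
  intro i j hij
  have hc : (preceding y i).card = (preceding y j).card := congrArg Fin.val hij
  by_contra hne
  have h : i ∈ preceding y j ∨ j ∈ preceding y i := by
    simp only [preceding, Finset.mem_filter, Finset.mem_univ, true_and]
    rcases lt_trichotomy (y i) (y j) with h | h | h
    · exact Or.inl (Or.inl h)
    · rcases lt_or_gt_of_ne hne with h' | h'
      · exact Or.inr (Or.inr ⟨h.symm, h'⟩)
      · exact Or.inl (Or.inr ⟨h, h'⟩)
    · exact Or.inr (Or.inl h)
  rcases h with h | h
  · exact absurd (card_preceding_lt_card y h) (by omega)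
  · exact absurd (card_preceding_lt_card y h) (by omega)

/-- The polarization of a biword with bottom row `y`: each letter is replaced by its rank, where
of two equal letters the one further to the right counts as the smaller. -/
noncomputable def polarization {n m : ℕ} (y : Fin n → Fin m) : Equiv.Perm (Fin n) :=
  Equiv.ofBijective _ (Finite.injective_iff_bijective.1 (rank_injective y))

/-- The set of all generalized involutions of length `n` over `m` letters, as pairs of
top row and bottom row. -/
def genInvolutions (n m : ℕ) : Finset ((Fin n → Fin m) × (Fin n → Fin m)) :=
  Finset.univ.filter fun α => IsGenInvolution α.1 α.2

/-- `Gen_m(σ)`: the generalized involutions over `m` letters with polarization `σ`. -/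
noncomputable def Gen {n : ℕ} (m : ℕ) (σ : Equiv.Perm (Fin n)) :
    Finset ((Fin n → Fin m) × (Fin n → Fin m)) :=
  (genInvolutions n m).filter fun α => polarization α.2 = σ

/-- The number of even generalized involutions: those whose polarization is even. -/
noncomputable def aPlus (n m : ℕ) : ℕ :=
  ((genInvolutions n m).filter fun α => Equiv.Perm.sign (polarization α.2) = 1).card

/-- The number of odd generalized involutions: those whose polarization is odd. -/
noncomputable def aMinus (n m : ℕ) : ℕ :=
  ((genInvolutions n m).filter fun α => Equiv.Perm.sign (polarization α.2) = -1).card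

/-- The number of even minus the number of odd generalized involutions. -/
noncomputable def aHat (n m : ℕ) : ℤ := (aPlus n m : ℤ) - (aMinus n m : ℤ)

end SignedEulerian

namespace SignedEulerian
open Finset

/-! ### Monotone words -/

/-! Both sides count generalized involutions by the sign of the polarization.

Left side: a generalized involution with polarization `σ` has bottom row `x ∘ σ`, so it is
determined by its top row `x`, and `σ` is an involution. The rows `x` that occur are the weakly
increasing ones that jump at each rise of `σ`. Subtracting from each letter the number of earlier
rises turns them into arbitrary weakly increasing words over an alphabet with `ris σ` fewer letters,
and these are counted by a binomial coefficient.

Right side: a generalized involution is also determined by its content, the number of occurrences of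
each unordered biletter; this number must be even off the diagonal. Within the class of one
unordered biletter the polarization has as many fixed points as the parity of the content, so the
sign is the product of `(-1) ^ (content / 2)`. A diagonal biletter thus contributes `(1 + X) / (1 +
X ^ 2)`, any other `1 / (1 + X ^ 2)`, and `aHat n m` is the coefficient of `X ^ n` in `(1 + X) ^ m /
(1 + X ^ 2) ^ (m + 1).choose 2`. -/

theorem count_ofFn {α : Type*} [DecidableEq α] {n : ℕ} (g : Fin n → α) (a : α) :
    (List.ofFn g).count a = #{i | g i = a} := by
  rw [← Multiset.coe_count, ← Fin.univ_val_map, Multiset.count_map]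
  simp only [Finset.card, Finset.filter_val, eq_comm]

/-- Uniqueness of sorting; every later identification of rows or biwords rests on it. -/
theorem eq_of_monotone_of_card_eq {α : Type*} [LinearOrder α] {n : ℕ} {g h : Fin n → α}
    (hg : Monotone g) (hh : Monotone h)
    (hc : ∀ a, #{i | g i = a} = #{i | h i = a}) : g = h := by
  apply List.ofFn_injective
  refine List.Perm.eq_of_pairwise' (r := (· ≤ ·)) (List.sortedLE_ofFn_iff.2 hg).pairwise
    (List.sortedLE_ofFn_iff.2 hh).pairwise ?_
  rw [List.perm_iff_count]
  intro a
  rw [count_ofFn, count_ofFn, hc]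

theorem exists_monotone_of_multiset {α : Type*} [LinearOrder α] {n : ℕ} (M : Multiset α)
    (hM : M.card = n) :
    ∃ g : Fin n → α, Monotone g ∧ Multiset.ofList (List.ofFn g) = M := by
  subst hM
  have hl : (M.sort (· ≤ ·)).length = M.card := Multiset.length_sort _
  have hs : (M.sort (· ≤ ·)).SortedLE := (Multiset.pairwise_sort (s := M) (r := (· ≤ ·))).sortedLE
  refine ⟨fun i => (M.sort (· ≤ ·)).get (Fin.cast hl.symm i), ?_, ?_⟩
  · intro i j hij
    exact List.sortedLE_iff_monotone_get.1 hs (by simpa using hij)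
  · conv_rhs => rw [← Multiset.sort_eq M (· ≤ ·)]
    congr 1
    apply List.ext_get
    · simp
    · intro i h1 h2
      simp

theorem exists_monotone_of_card {α : Type*} [LinearOrder α] [Fintype α] {n : ℕ} (c : α → ℕ)
    (hc : ∑ a, c a = n) :
    ∃ g : Fin n → α, Monotone g ∧ ∀ a, #{i | g i = a} = c a := by
  obtain ⟨g, hg, hgM⟩ := exists_monotone_of_multiset (n := n)
    (Finsupp.toMultiset (Finsupp.equivFunOnFinite.symm c)) (by
      rw [Finsupp.card_toMultiset, Finsupp.sum_fintype _ _ (fun _ => rfl)]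
      simpa using hc)
  refine ⟨g, hg, fun a => ?_⟩
  rw [← count_ofFn, ← Multiset.coe_count, hgM, Finsupp.count_toMultiset]
  rfl

theorem card_monotone (n k : ℕ) :
    #{g : Fin n → Fin k | Monotone g} = k.multichoose n := by
  have h := Sym.card_sym_eq_multichoose (Fin k) n
  rw [Fintype.card_fin] at h
  rw [← h, ← Finset.card_univ]
  refine Finset.card_bij
    (fun g _ => (⟨Multiset.ofList (List.ofFn g), by simp⟩ : Sym (Fin k) n))
    (fun _ _ => mem_univ _) ?_ ?_
  · intro g hg h hh hgh
    simp only [mem_filter, mem_univ, true_and] at hg hh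
    refine eq_of_monotone_of_card_eq hg hh fun a => ?_
    have := congrArg (fun M : Sym (Fin k) n => (M : Multiset (Fin k)).count a) hgh
    simpa [Sym.coe_mk, count_ofFn] using this
  · intro M _
    obtain ⟨g, hg, hgM⟩ := exists_monotone_of_multiset (M : Multiset (Fin k)) M.2
    exact ⟨g, by simpa using hg, Subtype.ext hgM⟩

theorem monotone_fin_of_step {α : Type*} [Preorder α] {n : ℕ} {g : Fin n → α}
    (h : ∀ (i : ℕ) (hi : i + 1 < n), g ⟨i, by omega⟩ ≤ g ⟨i + 1, hi⟩) : Monotone g := by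
  have key : ∀ (d i : ℕ) (hi : i + d < n), g ⟨i, by omega⟩ ≤ g ⟨i + d, hi⟩ := by
    intro d
    induction d with
    | zero => intro i hi; exact le_rfl
    | succ d ih => intro i hi; exact (ih i (by omega)).trans (h (i + d) hi)
  intro i j hij
  have := key (j.val - i.val) i.val (by omega)
  have hj : i.val + (j.val - i.val) = j.val := by have : i.val ≤ j.val := hij; omega
  simpa only [hj] using this

/-! ### Polarization -/

theorem mem_preceding {n m : ℕ} {y : Fin n → Fin m} {i j : Fin n} :
    i ∈ preceding y j ↔ y i < y j ∨ (y i = y j ∧ j < i) := by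
  simp [preceding]

theorem preceding_total {n m : ℕ} (y : Fin n → Fin m) {i j : Fin n} (h : i ≠ j) :
    i ∈ preceding y j ∨ j ∈ preceding y i := by
  simp only [mem_preceding]
  rcases lt_trichotomy (y i) (y j) with h' | h' | h' <;>
    rcases lt_or_gt_of_ne h with h'' | h'' <;> simp [h', h'']

theorem polarization_lt_of_mem {n m : ℕ} {y : Fin n → Fin m} {i j : Fin n}
    (h : i ∈ preceding y j) : polarization y i < polarization y j :=
  Fin.lt_def.2 (card_preceding_lt_card y h)

theorem polarization_lt_iff {n m : ℕ} {y : Fin n → Fin m} {i j : Fin n} :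
    polarization y i < polarization y j ↔ y i < y j ∨ (y i = y j ∧ j < i) := by
  rw [← mem_preceding]
  refine ⟨fun h => ?_, polarization_lt_of_mem⟩
  have hne : i ≠ j := by rintro rfl; exact lt_irrefl _ h
  exact (preceding_total y hne).resolve_right fun h' =>
    lt_asymm h (polarization_lt_of_mem h')

theorem perm_eq_one_of_strictMono {n : ℕ} (τ : Equiv.Perm (Fin n)) (h : StrictMono τ) :
    τ = 1 := by
  have h1 : (τ : Fin n → Fin n) = id :=
    eq_of_monotone_of_card_eq h.monotone monotone_id fun a => by
      refine Finset.card_bij (fun i _ => τ i) ?_ ?_ ?_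
      · intro i hi; simpa using hi
      · intro i _ j _ hij; exact τ.injective hij
      · intro b hb
        exact ⟨τ.symm b, by simpa using hb, by simp⟩
  exact Equiv.ext fun i => congrFun h1 i

theorem eq_polarization_of_lt {n m : ℕ} {y : Fin n → Fin m} {σ : Equiv.Perm (Fin n)}
    (h : ∀ i j, y i < y j ∨ (y i = y j ∧ j < i) → σ i < σ j) : polarization y = σ := by
  have h1 : σ * (polarization y)⁻¹ = 1 := by
    apply perm_eq_one_of_strictMono
    intro a b hab
    simp only [Equiv.Perm.mul_apply]
    apply h
    rw [← polarization_lt_iff]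
    simpa using hab
  exact (mul_inv_eq_one.1 h1).symm

/-! ### Generalized involutions and their polarizations -/

section GenInvolution

variable {n m : ℕ} {x y : Fin n → Fin m}

theorem IsGenInvolution.card_top_eq_card_bottom (h : IsGenInvolution x y) (a : Fin m) :
    #{i | x i = a} = #{i | y i = a} := by
  have h1 : #{i | x i = a} = ∑ b, #{i | x i = a ∧ y i = b} := by
    rw [Finset.card_eq_sum_card_fiberwise (f := y) (t := univ) (fun _ _ => by simp)]
    simp only [filter_filter]
  have h2 : #{i | y i = a} = ∑ b, #{i | x i = b ∧ y i = a} := by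
    rw [Finset.card_eq_sum_card_fiberwise (f := x) (t := univ) (fun _ _ => by simp)]
    simp only [filter_filter, and_comm]
  rw [h1, h2]
  exact Finset.sum_congr rfl fun b _ => h.2.2 a b

theorem card_comp_perm {α : Type*} [DecidableEq α] (τ : Equiv.Perm (Fin n)) (g : Fin n → α)
    (a : α) : #{i | g (τ i) = a} = #{i | g i = a} := by
  refine Finset.card_bij (fun i _ => τ i) ?_ ?_ ?_
  · intro i hi; simpa using hi
  · intro i _ j _ hij; exact τ.injective hij
  · intro b hb
    exact ⟨τ.symm b, by simpa using hb, by simp⟩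

/-- The inverse of the polarization sorts the bottom row, and the top row is a sorted word with the
same letters. -/
theorem IsGenInvolution.top_polarization (h : IsGenInvolution x y) (i : Fin n) :
    x (polarization y i) = y i := by
  have hmono : Monotone (y ∘ (polarization y).symm) := by
    intro a b hab
    rcases hab.eq_or_lt with rfl | hab
    · exact le_rfl
    have : polarization y ((polarization y).symm a) < polarization y ((polarization y).symm b) := by
      simpa using hab
    rcases polarization_lt_iff.1 this with h' | h'
    · exact h'.le
    · exact h'.1.le
  have hx : x = y ∘ (polarization y).symm :=
    eq_of_monotone_of_card_eq (fun i j hij => h.1 i j hij) hmono fun a => by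
      rw [h.card_top_eq_card_bottom a]
      exact (card_comp_perm (polarization y).symm y a).symm
  rw [hx]
  simp

/-- The biword with rows `x` and `y`, in the order in which its biletters must increase. -/
def biword (x y : Fin n → Fin m) (i : Fin n) : Fin m ×ₗ (Fin m)ᵒᵈ :=
  toLex (x i, OrderDual.toDual (y i))

theorem biword_eq_iff {i : Fin n} {a b : Fin m} :
    biword x y i = toLex (a, OrderDual.toDual b) ↔ x i = a ∧ y i = b := by
  simp [biword]

theorem card_biword_eq (x y : Fin n → Fin m) (a b : Fin m) :
    #{i | biword x y i = toLex (a, OrderDual.toDual b)} = #{i | x i = a ∧ y i = b} := by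
  simp only [biword_eq_iff]

theorem monotone_biword_iff :
    Monotone (biword x y) ↔
      (∀ i j, i ≤ j → x i ≤ x j) ∧ (∀ i j, i ≤ j → x i = x j → y j ≤ y i) := by
  simp only [Monotone, biword, Prod.Lex.toLex_le_toLex]
  constructor
  · intro h
    refine ⟨fun i j hij => ?_, fun i j hij he => ?_⟩
    · rcases h hij with h' | h'
      · exact h'.le
      · exact h'.1.le
    · rcases h hij with h' | h'
      · exact absurd he h'.ne
      · simpa using h'.2
  · intro h i j hij
    rcases (h.1 i j hij).lt_or_eq with h' | h'
    · exact Or.inl h'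
    · exact Or.inr ⟨h', by simpa using h.2 i j hij h'⟩

theorem IsGenInvolution.monotone_biword (h : IsGenInvolution x y) : Monotone (biword x y) :=
  monotone_biword_iff.2 ⟨h.1, h.2.1⟩

theorem IsGenInvolution.polarization_lt_of_top_eq (h : IsGenInvolution x y) {p q : Fin n}
    (hpq : p < q) (hx : x p = x q) : polarization y q < polarization y p := by
  rw [polarization_lt_iff]
  rcases (h.2.1 p q hpq.le hx).lt_or_eq with h' | h'
  · exact Or.inl h'
  · exact Or.inr ⟨h', hpq⟩

theorem IsGenInvolution.polarization_mul_self (h : IsGenInvolution x y) :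
    polarization y * polarization y = 1 := by
  set σ := polarization y with hσ
  -- swapping the two rows and sorting gives back the same biword
  have hw : biword x y = biword x (fun i => x (σ.symm i)) := by
    refine eq_of_monotone_of_card_eq h.monotone_biword (monotone_biword_iff.2 ⟨h.1, ?_⟩) ?_
    · intro i j hij he
      rcases hij.eq_or_lt with rfl | hij
      · exact le_rfl
      apply h.1
      by_contra hlt
      rw [not_le] at hlt
      have h1 : σ (σ.symm i) < σ (σ.symm j) := by simpa using hij
      have hy : ∀ k, y (σ.symm k) = x k := fun k => by
        rw [← h.top_polarization]; simp [hσ]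
      rcases polarization_lt_iff.1 h1 with h2 | h2
      · rw [hy, hy, he] at h2; exact lt_irrefl _ h2
      · exact lt_asymm hlt h2.2
    · intro c
      obtain ⟨⟨a, b⟩, rfl⟩ := toLex.surjective c
      obtain ⟨b, rfl⟩ := OrderDual.toDual.surjective b
      rw [card_biword_eq, card_biword_eq, h.2.2]
      refine Finset.card_bij (fun i _ => σ i) ?_ ?_ ?_
      · intro i hi
        simp only [mem_filter, mem_univ, true_and, Equiv.symm_apply_apply] at hi ⊢
        exact ⟨(h.top_polarization i).trans hi.2, hi.1⟩
      · intro i _ j _ hij; exact σ.injective hij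
      · intro i hi
        simp only [mem_filter, mem_univ, true_and] at hi
        refine ⟨σ.symm i, ?_, by simp⟩
        simp only [mem_filter, mem_univ, true_and]
        refine ⟨hi.2, ?_⟩
        rw [← h.top_polarization]
        simpa [hσ] using hi.1
  have hy : ∀ i, y i = x (σ.symm i) := fun i => by
    have := congrFun hw i
    rw [biword, biword] at this
    simpa using this
  -- Since `y ∘ σ = x`, the square of `σ` orders positions by their top letters. Among equal top
  -- letters `σ` is decreasing and the tie rule reverses once more, so the square is increasing.
  apply perm_eq_one_of_strictMono
  intro a b hab
  simp only [Equiv.Perm.mul_apply]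
  rw [hσ, polarization_lt_iff, ← hσ, hy, hy]
  simp only [Equiv.symm_apply_apply]
  rcases (h.1 a b hab.le).lt_or_eq with h' | h'
  · exact Or.inl h'
  · exact Or.inr ⟨h', h.polarization_lt_of_top_eq hab h'⟩

end GenInvolution

/-! ### The number of generalized involutions with a given polarization -/

section Weights

variable {n m : ℕ}

/-- `x` is weakly increasing, and strictly so at the rises of `σ`. -/
def Admissible (σ : Equiv.Perm (Fin n)) (x : Fin n → Fin m) : Prop :=
  Monotone x ∧ ∀ (i : ℕ) (hi : i + 1 < n),
    σ ⟨i, by omega⟩ < σ ⟨i + 1, hi⟩ → x ⟨i, by omega⟩ < x ⟨i + 1, hi⟩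

theorem IsGenInvolution.admissible {x y : Fin n → Fin m} (h : IsGenInvolution x y) :
    Admissible (polarization y) x := by
  refine ⟨fun i j hij => h.1 i j hij, fun i hi hlt => ?_⟩
  have hi' : (⟨i, by omega⟩ : Fin n) < ⟨i + 1, hi⟩ := Fin.mk_lt_mk.2 (by omega)
  refine lt_of_le_of_ne (h.1 _ _ hi'.le) fun he => ?_
  exact lt_asymm hlt (h.polarization_lt_of_top_eq hi' he)

theorem Admissible.lt_of_eq {σ : Equiv.Perm (Fin n)} {x : Fin n → Fin m} (h : Admissible σ x)
    {p q : Fin n} (hpq : p < q) (hx : x p = x q) : σ q < σ p := by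
  have key : ∀ (d i : ℕ) (hi : i + d + 1 < n), x ⟨i, by omega⟩ = x ⟨i + d + 1, hi⟩ →
      σ ⟨i + d + 1, hi⟩ < σ ⟨i, by omega⟩ := by
    intro d
    induction d with
    | zero =>
      intro i hi he
      refine lt_of_le_of_ne (not_lt.1 fun hlt => (h.2 i hi hlt).ne he) fun h' => ?_
      have := Fin.mk.inj_iff.1 (σ.injective h')
      omega
    | succ d ih =>
      intro i hi he
      have h1 : x ⟨i, by omega⟩ ≤ x ⟨i + d + 1, by omega⟩ := h.1 (Fin.mk_le_mk.2 (by omega))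
      have h2 : x ⟨i + d + 1, by omega⟩ ≤ x ⟨i + d + 1 + 1, hi⟩ := h.1 (Fin.mk_le_mk.2 (by omega))
      have h3 : x ⟨i, by omega⟩ = x ⟨i + d + 1, by omega⟩ := le_antisymm h1 (h2.trans he.ge)
      refine lt_trans ?_ (ih i (by omega) h3)
      refine lt_of_le_of_ne (not_lt.1 fun hlt => ?_) fun h' => ?_
      · exact (h.2 (i + d + 1) hi hlt).ne (h3.symm.trans he)
      · have := Fin.mk.inj_iff.1 (σ.injective h')
        omega
  have hpq' : p.val < q.val := hpq
  have hq : p.val + (q.val - p.val - 1) + 1 = q.val := by omega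
  have := key (q.val - p.val - 1) p.val (by omega)
  simp only [hq] at this
  exact this hx

/-- The bottom row is forced by `top_polarization`; `σ` exchanges the occurrences of `(a, b)` with
those of `(b, a)`. -/
theorem Admissible.mem_Gen {σ : Equiv.Perm (Fin n)} (hσ : σ * σ = 1) {x : Fin n → Fin m}
    (h : Admissible σ x) : (x, fun i => x (σ i)) ∈ Gen m σ := by
  have hσσ : ∀ i, σ (σ i) = i := fun i => by
    rw [← Equiv.Perm.mul_apply, hσ, Equiv.Perm.one_apply]
  simp only [Gen, genInvolutions, mem_filter, mem_univ, true_and]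
  refine ⟨⟨fun i j hij => h.1 hij, fun i j hij he => ?_, fun a b => ?_⟩, ?_⟩
  · rcases hij.eq_or_lt with rfl | hij
    · exact le_rfl
    · exact h.1 (h.lt_of_eq hij he).le
  · refine Finset.card_bij (fun i _ => σ i) ?_ ?_ ?_
    · intro i hi
      simp only [mem_filter, mem_univ, true_and, hσσ] at hi ⊢
      exact hi.symm
    · intro i _ j _ hij; exact σ.injective hij
    · intro i hi
      refine ⟨σ i, ?_, hσσ i⟩
      simp only [mem_filter, mem_univ, true_and, hσσ] at hi ⊢
      exact hi.symm
  · apply eq_polarization_of_lt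
    rintro i j (hij | ⟨he, hji⟩)
    · exact not_le.1 fun hle => not_lt.2 (h.1 hle) hij
    · refine lt_of_le_of_ne (not_lt.1 fun hlt => ?_) fun h' => hji.ne (σ.injective h').symm
      have := h.lt_of_eq hlt he.symm
      rw [hσσ, hσσ] at this
      exact lt_asymm hji this

open Classical in
theorem card_Gen_eq_card_admissible {σ : Equiv.Perm (Fin n)} (hσ : σ * σ = 1) :
    (Gen m σ).card = #{x : Fin n → Fin m | Admissible σ x} := by
  symm
  refine Finset.card_bij (fun x _ => (x, fun i => x (σ i))) ?_ ?_ ?_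
  · intro x hx
    exact Admissible.mem_Gen hσ (by simpa using hx)
  · intro x _ x' _ he
    exact congrArg Prod.fst he
  · rintro ⟨x, y⟩ hxy
    simp only [Gen, genInvolutions, mem_filter, mem_univ, true_and] at hxy
    obtain ⟨hxy, rfl⟩ := hxy
    exact ⟨x, by simpa using hxy.admissible, Prod.ext rfl (funext hxy.top_polarization)⟩

/-- The number of rises of `σ` at positions below `k`. -/
def risBelow (σ : Equiv.Perm (Fin n)) (k : ℕ) : ℕ :=
  #{i : Fin n | i.val < k ∧ ∃ h : i.val + 1 < n, σ i < σ ⟨i.val + 1, h⟩}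

theorem risBelow_zero (σ : Equiv.Perm (Fin n)) : risBelow σ 0 = 0 := by
  simp [risBelow]

theorem risBelow_pred (σ : Equiv.Perm (Fin n)) : risBelow σ (n - 1) = ris σ := by
  unfold risBelow ris
  congr 1
  ext i
  simp only [mem_filter, mem_univ, true_and, and_iff_right_iff_imp, forall_exists_index]
  intro h _
  omega

theorem risBelow_le_ris (σ : Equiv.Perm (Fin n)) (k : ℕ) : risBelow σ k ≤ ris σ :=
  Finset.card_le_card fun i hi => by
    simp only [mem_filter, mem_univ, true_and] at hi ⊢
    exact hi.2

theorem risBelow_succ (σ : Equiv.Perm (Fin n)) (k : ℕ) (hk : k + 1 < n) :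
    risBelow σ (k + 1) =
      risBelow σ k + if σ ⟨k, by omega⟩ < σ ⟨k + 1, hk⟩ then 1 else 0 := by
  unfold risBelow
  split_ifs with h
  · have : (univ.filter fun i : Fin n => i.val < k + 1 ∧ ∃ h : i.val + 1 < n,
        σ i < σ ⟨i.val + 1, h⟩) = insert ⟨k, by omega⟩ (univ.filter fun i : Fin n => i.val < k ∧
          ∃ h : i.val + 1 < n, σ i < σ ⟨i.val + 1, h⟩) := by
      ext i
      simp only [mem_filter, mem_univ, true_and, mem_insert, Fin.ext_iff]
      constructor
      · rintro ⟨h1, h2⟩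
        rcases Nat.lt_succ_iff_lt_or_eq.1 h1 with h1 | h1
        · exact Or.inr ⟨h1, h2⟩
        · exact Or.inl h1
      · rintro (h1 | ⟨h1, h2⟩)
        · subst h1
          exact ⟨Nat.lt_succ_self _, hk, h⟩
        · exact ⟨by omega, h2⟩
    rw [this, card_insert_of_notMem (by simp)]
  · rw [add_zero]
    congr 1
    ext i
    simp only [mem_filter, mem_univ, true_and, and_congr_left_iff, forall_exists_index]
    intro h1 h2
    refine ⟨fun h3 => ?_, fun h3 => by omega⟩
    rcases Nat.lt_succ_iff_lt_or_eq.1 h3 with h3 | h3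
    · exact h3
    · subst h3
      exact absurd h2 h

/-- Each unit of growth of `risBelow` is paid for by a strict increase of `x`. The difference is
taken in `ℤ` because its nonnegativity is only established afterwards, in `bounds`. -/
theorem Admissible.monotone_sub {σ : Equiv.Perm (Fin n)} {x : Fin n → Fin m}
    (h : Admissible σ x) : Monotone fun i : Fin n => (x i : ℤ) - risBelow σ i := by
  apply monotone_fin_of_step
  intro i hi
  simp only [risBelow_succ σ i hi]
  have h1 : (x ⟨i, by omega⟩).val ≤ (x ⟨i + 1, hi⟩).val := h.1 (Fin.mk_le_mk.2 (by omega))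
  split_ifs with hr
  · have h2 : (x ⟨i, by omega⟩).val < (x ⟨i + 1, hi⟩).val := h.2 i hi hr
    push_cast; omega
  · push_cast; omega

/-- Compare with the first position, where no rise has occurred, and the last, where all have. -/
theorem Admissible.bounds {σ : Equiv.Perm (Fin n)} {x : Fin n → Fin m}
    (h : Admissible σ x) (i : Fin n) :
    risBelow σ i ≤ x i ∧ (x i).val + ris σ + 1 ≤ m + risBelow σ i := by
  have hn : 0 < n := i.pos
  have h0 := h.monotone_sub (a := ⟨0, hn⟩) (b := i) (Fin.mk_le_of_le_val (Nat.zero_le _))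
  have h1 := h.monotone_sub (a := i) (b := ⟨n - 1, by omega⟩)
    (Fin.le_def.2 (by simp only; omega))
  simp only [risBelow_zero, risBelow_pred] at h0 h1
  have := (x ⟨n - 1, by omega⟩).isLt
  omega

open Classical in
-- Adding `risBelow` is a bijection from the weakly increasing words over `j + 1` letters.
theorem card_admissible (σ : Equiv.Perm (Fin n)) (j : ℕ) :
    #{x : Fin n → Fin (ris σ + j + 1) | Admissible σ x} = (n + j).choose j := by
  have hc : (n + j).choose j = #{g : Fin n → Fin (j + 1) | Monotone g} := by
    rw [card_monotone, Nat.multichoose_eq, show j + 1 + n - 1 = n + j by omega,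
      Nat.choose_symm_add]
  rw [hc]
  symm
  refine Finset.card_bij
    (fun g _ i => ⟨(g i).val + risBelow σ i, by
      have := (g i).isLt; have := risBelow_le_ris σ i; omega⟩) ?_ ?_ ?_
  · intro g hg
    simp only [mem_filter, mem_univ, true_and] at hg ⊢
    refine ⟨monotone_fin_of_step fun i hi => ?_, fun i hi hr => ?_⟩
    · have : (g ⟨i, by omega⟩).val ≤ (g ⟨i + 1, hi⟩).val := hg (Fin.mk_le_mk.2 (by omega))
      simp only [Fin.mk_le_mk, risBelow_succ σ i hi]
      omega
    · have : (g ⟨i, by omega⟩).val ≤ (g ⟨i + 1, hi⟩).val := hg (Fin.mk_le_mk.2 (by omega))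
      simp only [Fin.mk_lt_mk, risBelow_succ σ i hi, if_pos hr]
      omega
  · intro g _ g' _ he
    funext i
    have := congrArg Fin.val (congrFun he i)
    simp only at this
    exact Fin.ext (by omega)
  · intro x hx
    simp only [mem_filter, mem_univ, true_and] at hx
    refine ⟨fun i => ⟨(x i).val - risBelow σ i, by have := hx.bounds i; omega⟩, ?_, ?_⟩
    · simp only [mem_filter, mem_univ, true_and]
      intro a b hab
      have h1 := hx.monotone_sub hab
      have h2 := hx.bounds a
      have h3 := hx.bounds b
      simp only at h1
      refine Fin.mk_le_mk.2 ?_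
      omega
    · funext i
      have h2 := hx.bounds i
      exact Fin.ext (by simp only; omega)

theorem card_Gen_of_ris_eq {σ : Equiv.Perm (Fin n)} (hσ : σ * σ = 1) {j : ℕ}
    (hj : j < m) (hr : ris σ = m - j - 1) : (Gen m σ).card = (n + j).choose j := by
  obtain rfl : m = ris σ + j + 1 := by omega
  rw [card_Gen_eq_card_admissible hσ, card_admissible]

theorem card_Gen_of_le_ris {σ : Equiv.Perm (Fin n)} (hσ : σ * σ = 1) (hnm : n ≠ 0 ∨ m ≠ 0)
    (hr : m ≤ ris σ) : (Gen m σ).card = 0 := by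
  classical
  -- An empty permutation has no rises, so `n = 0` would force `m = 0`, the excluded case in which
  -- the empty biword is counted.
  have hn : n ≠ 0 := by
    rintro rfl
    have : ris σ = 0 := by simp [ris]
    omega
  rw [card_Gen_eq_card_admissible hσ, Finset.card_eq_zero, Finset.filter_eq_empty_iff]
  intro x _ hx
  have := hx.bounds ⟨0, by omega⟩
  simp only [risBelow_zero] at this
  omega

/-! ### The left-hand side as a signed count -/

theorem sum_choose_mul_f_eq (hnm : n ≠ 0 ∨ m ≠ 0) :
    ∑ j ∈ range m, ((n + j).choose j : ℤ) * f n (m - j - 1) =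
      ∑ σ ∈ involutions n, ((Equiv.Perm.sign σ : ℤˣ) : ℤ) * ((Gen m σ).card : ℤ) := by
  have hf : ∀ k, f n k = ∑ σ ∈ involutions n,
      ((Equiv.Perm.sign σ : ℤˣ) : ℤ) * if k = ris σ then 1 else 0 := fun k => by
    simp only [f, F, Polynomial.finsetSum_coeff, Polynomial.coeff_C_mul, Polynomial.coeff_X_pow]
  simp only [hf, mul_sum]
  rw [sum_comm]
  refine sum_congr rfl fun σ hσ => ?_
  have hσ' : σ * σ = 1 := by simpa [involutions] using hσ
  by_cases hr : m ≤ ris σ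
  · rw [card_Gen_of_le_ris hσ' hnm hr]
    simp only [Nat.cast_zero, mul_zero]
    refine sum_eq_zero fun j hj => ?_
    rw [mem_range] at hj
    rw [if_neg (by omega)]
    simp
  · rw [sum_eq_single (m - ris σ - 1)]
    · rw [if_pos (by omega), card_Gen_of_ris_eq hσ' (j := m - ris σ - 1) (by omega) (by omega)]
      ring
    · intro j hj hne
      rw [mem_range] at hj
      rw [if_neg (by omega)]
      simp
    · intro h
      rw [mem_range] at h
      omega

theorem polarization_mem_involutions {x y : Fin n → Fin m} (h : IsGenInvolution x y) :
    polarization y ∈ involutions n := by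
  simpa [involutions] using h.polarization_mul_self

theorem aHat_eq_sum_sign (n m : ℕ) :
    aHat n m = ∑ α ∈ genInvolutions n m, ((Equiv.Perm.sign (polarization α.2) : ℤˣ) : ℤ) := by
  unfold aHat aPlus aMinus
  rw [Finset.card_filter, Finset.card_filter, Nat.cast_sum, Nat.cast_sum, ← Finset.sum_sub_distrib]
  refine sum_congr rfl fun α _ => ?_
  rcases Int.units_eq_one_or (Equiv.Perm.sign (polarization α.2)) with h | h <;> rw [h] <;> simp

theorem sum_sign_mul_card_Gen (n m : ℕ) :
    ∑ σ ∈ involutions n, ((Equiv.Perm.sign σ : ℤˣ) : ℤ) * ((Gen m σ).card : ℤ) = aHat n m := by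
  rw [aHat_eq_sum_sign, ← Finset.sum_fiberwise_of_maps_to
    (s := genInvolutions n m) (t := involutions n) (g := fun α => polarization α.2)
    (fun α hα => polarization_mem_involutions (by simpa [genInvolutions] using hα))]
  refine sum_congr rfl fun σ _ => ?_
  rw [Finset.sum_congr rfl fun α hα => by rw [(mem_filter.1 hα).2], sum_const, nsmul_eq_mul,
    mul_comm, Gen]

end Weights

/-! ### The sign of the polarization -/

/-- The points that are not fixed fall into pairs. -/
theorem card_fixed_mod_two {α : Type*} [DecidableEq α] (S : Finset α) (g : α → α)
    (hmem : ∀ i ∈ S, g i ∈ S) (hg : ∀ i ∈ S, g (g i) = i) :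
    #{i ∈ S | g i = i} % 2 = #S % 2 := by
  have h : ∑ i ∈ S with g i ≠ i, (1 : ZMod 2) = 0 := by
    refine Finset.sum_involution (fun i _ => g i) ?_ ?_ ?_ ?_
    · intro _ _; decide
    · intro i hi _; exact (mem_filter.1 hi).2
    · intro i hi
      have := mem_filter.1 hi
      exact mem_filter.2 ⟨hmem i this.1, by rw [hg i this.1]; exact this.2.symm⟩
    · intro i hi; exact hg i (mem_filter.1 hi).1
  rw [sum_const, nsmul_eq_mul, mul_one, ZMod.natCast_eq_zero_iff] at h
  have := Finset.card_filter_add_card_filter_not (s := S) (fun i => g i = i)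
  simp only [ne_eq] at h
  omega

/-- All nontrivial cycles are transpositions, and half of the moved points is their number. -/
theorem sign_of_mul_self_eq_one {n : ℕ} {σ : Equiv.Perm (Fin n)} (hσ : σ * σ = 1) :
    Equiv.Perm.sign σ = (-1) ^ ((n - #{i | σ i = i}) / 2) := by
  have h2 : σ.cycleType = Multiset.replicate (Multiset.card σ.cycleType) 2 :=
    Multiset.eq_replicate.2 ⟨rfl, Equiv.Perm.pow_prime_eq_one_iff.1 (by rw [pow_two, hσ])⟩
  have hs := σ.sum_cycleType
  rw [Equiv.Perm.sign_of_cycleType]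
  have hsum : σ.cycleType.sum = Multiset.card σ.cycleType * 2 := by
    conv_lhs => rw [h2]
    simp
  have hsupp : #σ.support + #{i | σ i = i} = n := by
    have := Finset.card_filter_add_card_filter_not (s := (univ : Finset (Fin n)))
      (fun i => σ i = i)
    rw [card_univ, Fintype.card_fin] at this
    rw [add_comm]
    exact this
  have : (n - #{i | σ i = i}) / 2 = Multiset.card σ.cycleType := by omega
  rw [this, hsum, pow_add, mul_comm, pow_mul]
  simp

/-! ### Contents: sign, uniqueness and existence -/

section Content

variable {n m : ℕ}

/-- The number of positions of a biword carrying one of the biletters `(a, b)` and `(b, a)`. -/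
def content (x y : Fin n → Fin m) (e : Sym2 (Fin m)) : ℕ :=
  #{i | s(x i, y i) = e}

theorem sum_content (x y : Fin n → Fin m) : ∑ e, content x y e = n := by
  have := Finset.card_eq_sum_card_fiberwise (s := (univ : Finset (Fin n)))
    (f := fun i => s(x i, y i)) (t := univ) (fun _ _ => by simp)
  rw [card_univ, Fintype.card_fin] at this
  exact this.symm

theorem IsGenInvolution.polarization_apply_self {x y : Fin n → Fin m}
    (h : IsGenInvolution x y) (i : Fin n) : polarization y (polarization y i) = i := by
  rw [← Equiv.Perm.mul_apply, h.polarization_mul_self, Equiv.Perm.one_apply]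

/-- The polarization swaps the two letters of a biletter, so it acts as an involution on each class;
parity then decides the count once there is at most one fixed point. -/
theorem IsGenInvolution.card_fixed_content {x y : Fin n → Fin m} (h : IsGenInvolution x y)
    (e : Sym2 (Fin m)) :
    #{i | polarization y i = i ∧ s(x i, y i) = e} = content x y e % 2 := by
  have hpar := card_fixed_mod_two (univ.filter fun i => s(x i, y i) = e) (polarization y)
    (fun i hi => by
      simp only [mem_filter, mem_univ, true_and] at hi ⊢
      rw [h.top_polarization, ← h.top_polarization (polarization y i),
        h.polarization_apply_self, Sym2.eq_swap]
      exact hi)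
    (fun i _ => h.polarization_apply_self i)
  rw [filter_filter] at hpar
  simp only [and_comm (a := s(x _, y _) = e)] at hpar
  have hle : #{i | polarization y i = i ∧ s(x i, y i) = e} ≤ 1 := by
    rw [Finset.card_le_one]
    -- A fixed position has equal top and bottom letters. Two of them in one class share their
    -- bottom letter, and the tie rule would make the polarization reverse their order.
    have key : ∀ i j, polarization y i = i → polarization y j = j →
        s(x i, y i) = s(x j, y j) → ¬ i < j := by
      intro i j hi hj he hij
      have hi' := h.top_polarization i
      have hj' := h.top_polarization j
      rw [hi] at hi'
      rw [hj] at hj'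
      rw [hi', hj'] at he
      have hy : y i = y j := by simpa using he
      have := polarization_lt_iff.2 (Or.inr ⟨hy.symm, hij⟩)
      rw [hi, hj] at this
      exact lt_asymm hij this
    intro i hi j hj
    simp only [mem_filter, mem_univ, true_and] at hi hj
    rcases lt_trichotomy i j with hij | hij | hij
    · exact absurd hij (key i j hi.1 hj.1 (hi.2.trans hj.2.symm))
    · exact hij
    · exact absurd hij (key j i hj.1 hi.1 (hj.2.trans hi.2.symm))
  unfold content
  omega

theorem IsGenInvolution.sign_polarization {x y : Fin n → Fin m} (h : IsGenInvolution x y) :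
    Equiv.Perm.sign (polarization y) = ∏ e, (-1) ^ (content x y e / 2) := by
  rw [sign_of_mul_self_eq_one h.polarization_mul_self, Finset.prod_pow_eq_pow_sum]
  congr 1
  have hfix : #{i | polarization y i = i} = ∑ e, content x y e % 2 := by
    rw [Finset.card_eq_sum_card_fiberwise (f := fun i => s(x i, y i)) (t := univ)
      (fun _ _ => by simp)]
    refine sum_congr rfl fun e _ => ?_
    rw [filter_filter, h.card_fixed_content]
  have hn := sum_content x y
  have : ∑ e, content x y e = 2 * ∑ e, content x y e / 2 + ∑ e, content x y e % 2 := by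
    rw [mul_sum, ← sum_add_distrib]
    exact sum_congr rfl fun e _ => (Nat.div_add_mod _ _).symm
  omega

/-- The multiplicity of the biletter `(a, b)` in a generalized involution of content `l`. -/
def multiplicity (l : Sym2 (Fin m) → ℕ) (a b : Fin m) : ℕ :=
  if a = b then l s(a, b) else l s(a, b) / 2

theorem IsGenInvolution.content_of_ne {x y : Fin n → Fin m} (h : IsGenInvolution x y)
    {a b : Fin m} (hab : a ≠ b) : content x y s(a, b) = 2 * #{i | x i = a ∧ y i = b} := by
  have : (univ.filter fun i => s(x i, y i) = s(a, b)) =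
      (univ.filter fun i => x i = a ∧ y i = b) ∪ univ.filter fun i => x i = b ∧ y i = a := by
    ext i; simp
  rw [content, this, card_union_of_disjoint, ← h.2.2 a b, two_mul]
  rw [Finset.disjoint_filter]
  rintro i _ ⟨h1, _⟩ ⟨h2, _⟩
  exact hab (h1.symm.trans h2)

theorem IsGenInvolution.card_biletter {x y : Fin n → Fin m} (h : IsGenInvolution x y)
    (a b : Fin m) : #{i | x i = a ∧ y i = b} = multiplicity (content x y) a b := by
  unfold multiplicity
  split_ifs with hab
  · subst hab
    unfold content
    congr 1
    ext i; simp
  · rw [h.content_of_ne hab]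
    omega

theorem IsGenInvolution.even_content {x y : Fin n → Fin m} (h : IsGenInvolution x y)
    {e : Sym2 (Fin m)} (he : ¬ e.IsDiag) : Even (content x y e) := by
  induction e with
  | _ a b =>
    rw [Sym2.mk_isDiag_iff] at he
    rw [h.content_of_ne he]
    exact even_two_mul _

/-- Symmetry recovers the multiplicity of each ordered biletter from the content, and a sorted
biword is determined by these. -/
theorem eq_of_content_eq {x y x' y' : Fin n → Fin m} (h : IsGenInvolution x y)
    (h' : IsGenInvolution x' y') (hc : content x y = content x' y') : x = x' ∧ y = y' := by
  have hw : biword x y = biword x' y' := by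
    refine eq_of_monotone_of_card_eq h.monotone_biword h'.monotone_biword fun c => ?_
    obtain ⟨⟨a, b⟩, rfl⟩ := toLex.surjective c
    obtain ⟨b, rfl⟩ := OrderDual.toDual.surjective b
    rw [card_biword_eq, card_biword_eq, h.card_biletter, h'.card_biletter, hc]
  have hi : ∀ i, x i = x' i ∧ y i = y' i := fun i => by
    have := congrFun hw i
    simpa [biword] using this
  exact ⟨funext fun i => (hi i).1, funext fun i => (hi i).2⟩

theorem sum_multiplicity (l : Sym2 (Fin m) → ℕ) (hl : ∀ e, ¬ e.IsDiag → Even (l e)) :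
    ∑ p : Fin m × Fin m, multiplicity l p.1 p.2 = ∑ e, l e := by
  rw [← Finset.sum_fiberwise (s := univ) (g := fun p : Fin m × Fin m => s(p.1, p.2))]
  refine sum_congr rfl fun e _ => ?_
  induction e with
  | _ a b =>
    have hset : (univ.filter fun p : Fin m × Fin m => s(p.1, p.2) = s(a, b)) =
        {(a, b), (b, a)} := by
      ext ⟨p, q⟩; simp
    rw [hset]
    by_cases hab : a = b
    · subst hab
      simp [multiplicity]
    · have he := hl s(a, b) (by rwa [Sym2.mk_isDiag_iff])
      rw [sum_pair (by simp [hab])]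
      simp only [multiplicity, if_neg hab, if_neg (Ne.symm hab), Sym2.eq_swap (a := b)]
      obtain ⟨k, hk⟩ := he
      omega

/-- Sort the multiset of biletters prescribed by `multiplicity`; the reversed order on the second
letter makes the bottom row decrease below equal top letters. -/
theorem exists_isGenInvolution (l : Sym2 (Fin m) → ℕ) (hl : ∀ e, ¬ e.IsDiag → Even (l e))
    (hn : ∑ e, l e = n) :
    ∃ x y : Fin n → Fin m, IsGenInvolution x y ∧ content x y = l := by
  obtain ⟨w, hw, hc⟩ := exists_monotone_of_card (α := Fin m ×ₗ (Fin m)ᵒᵈ) (n := n)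
    (fun c => multiplicity l (ofLex c).1 (OrderDual.ofDual (ofLex c).2)) (by
      rw [← hn, ← sum_multiplicity l hl]
      exact Fintype.sum_equiv
        (ofLex.trans (Equiv.prodCongr (Equiv.refl _) OrderDual.ofDual)) _ _ fun _ => rfl)
  set x : Fin n → Fin m := fun i => (ofLex (w i)).1 with hx
  set y : Fin n → Fin m := fun i => OrderDual.ofDual (ofLex (w i)).2 with hy
  have hwb : biword x y = w := rfl
  have hcard : ∀ a b, #{i | x i = a ∧ y i = b} = multiplicity l a b := fun a b => by
    rw [← card_biword_eq, hwb, hc]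
    rfl
  have hxy : IsGenInvolution x y := by
    have := monotone_biword_iff.1 (hwb ▸ hw)
    refine ⟨this.1, this.2, fun a b => ?_⟩
    rw [hcard, hcard, multiplicity, multiplicity, Sym2.eq_swap]
    simp only [eq_comm]
  refine ⟨x, y, hxy, funext fun e => ?_⟩
  induction e with
  | _ a b =>
    have h1 := hxy.card_biletter a b
    rw [hcard] at h1
    unfold multiplicity at h1
    split_ifs at h1 with hab
    · exact h1.symm
    · have h2 := hxy.even_content (e := s(a, b)) (by rwa [Sym2.mk_isDiag_iff])
      have h3 := hl s(a, b) (by rwa [Sym2.mk_isDiag_iff])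
      obtain ⟨p, hp⟩ := h2
      obtain ⟨q, hq⟩ := h3
      omega

end Content

/-! ### The generating function -/

open PowerSeries

/-- The generating function of the contributions of one unordered biletter. -/
noncomputable def contentSeries {m : ℕ} (e : Sym2 (Fin m)) : PowerSeries ℤ :=
  PowerSeries.mk fun d => if ¬ e.IsDiag ∧ ¬ Even d then 0 else (-1) ^ (d / 2)

/-- Expanding the product gives a sum over all contents of total `n`; those not realized by a
generalized involution are odd at some off-diagonal biletter, where the factor vanishes. -/
theorem aHat_eq_coeff (n m : ℕ) :
    aHat n m = coeff n (∏ e : Sym2 (Fin m), contentSeries e) := by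
  rw [aHat_eq_sum_sign, coeff_prod]
  refine Finset.sum_of_injOn (fun α => Finsupp.equivFunOnFinite.symm (content α.1 α.2)) ?_ ?_ ?_ ?_
  · rintro ⟨x, y⟩ h ⟨x', y'⟩ h' he
    simp only [genInvolutions, coe_filter, mem_univ, true_and, Set.mem_ofPred_eq] at h h'
    obtain ⟨rfl, rfl⟩ := eq_of_content_eq h h' (Finsupp.equivFunOnFinite.symm.injective he)
    rfl
  · rintro ⟨x, y⟩ h
    simp [mem_finsuppAntidiag, sum_content]
  · intro l hl hnot
    by_contra hne
    rw [← ne_eq, Finset.prod_ne_zero_iff] at hne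
    obtain ⟨x, y, hxy, hc⟩ := exists_isGenInvolution (n := n) (fun e => l e) (fun e he => by
      by_contra hodd
      apply hne e (mem_univ _)
      rw [contentSeries, coeff_mk, if_pos ⟨he, hodd⟩]) (mem_finsuppAntidiag.1 hl).1
    apply hnot
    refine ⟨(x, y), by simpa [genInvolutions] using hxy, ?_⟩
    ext e
    exact congrFun hc e
  · rintro ⟨x, y⟩ h
    have hxy : IsGenInvolution x y := by simpa [genInvolutions] using h
    simp only [hxy.sign_polarization, Units.coe_prod]
    refine prod_congr rfl fun e _ => ?_
    rw [contentSeries, coeff_mk, if_neg]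
    · simp
    · rintro ⟨h1, h2⟩
      exact h2 (hxy.even_content h1)

/-- The expansion of `(1 + X ^ 2) ^ (-N)`. -/
noncomputable def invOneAddSqPow (N : ℕ) : PowerSeries ℤ :=
  PowerSeries.mk fun d => if Even d then (-1) ^ (d / 2) * (N.multichoose (d / 2) : ℤ) else 0

theorem invOneAddSqPow_zero : invOneAddSqPow 0 = 1 := by
  ext d
  rw [invOneAddSqPow, coeff_mk, coeff_one]
  rcases d with _ | _ | d
  · simp
  · simp
  · rw [show (d + 1 + 1) / 2 = d / 2 + 1 by omega]
    simp

theorem one_add_sq_mul_invOneAddSqPow (N : ℕ) :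
    (1 + X ^ 2) * invOneAddSqPow (N + 1) = invOneAddSqPow N := by
  ext d
  rw [add_mul, one_mul, map_add, coeff_X_pow_mul']
  simp only [invOneAddSqPow, coeff_mk]
  rcases d with _ | _ | d
  · simp
  · simp
  · rw [if_pos (show 2 ≤ d + 1 + 1 by omega), show (d + 1 + 1) / 2 = d / 2 + 1 by omega,
      show d + 1 + 1 - 2 = d by omega, Nat.multichoose_succ_succ]
    have : Even (d + 1 + 1) ↔ Even d := by simp [Nat.even_add_one]
    simp only [this]
    split_ifs
    · push_cast; ring
    · simp

theorem one_add_sq_pow_mul_invOneAddSqPow (N : ℕ) :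
    (1 + X ^ 2 : PowerSeries ℤ) ^ N * invOneAddSqPow N = 1 := by
  induction N with
  | zero => simp [invOneAddSqPow_zero]
  | succ N ih => rw [pow_succ, mul_assoc, one_add_sq_mul_invOneAddSqPow, ih]

/-- Coefficients two apart have opposite signs, so all but those in degrees 0 and 1 cancel. -/
theorem one_add_sq_mul_contentSeries {m : ℕ} (e : Sym2 (Fin m)) :
    (1 + X ^ 2) * contentSeries e = if e.IsDiag then 1 + X else 1 := by
  ext d
  rw [add_mul, one_mul, map_add, coeff_X_pow_mul']
  simp only [contentSeries, coeff_mk]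
  rcases d with _ | _ | d
  · by_cases he : e.IsDiag <;> simp [he]
  · by_cases he : e.IsDiag <;> simp [he, coeff_one]
  · rw [if_pos (show 2 ≤ d + 1 + 1 by omega), show (d + 1 + 1) / 2 = d / 2 + 1 by omega,
      show d + 1 + 1 - 2 = d by omega]
    have : Even (d + 1 + 1) ↔ Even d := by simp [Nat.even_add_one]
    simp only [this]
    by_cases he : e.IsDiag <;> by_cases hd : Even d <;>
      simp [he, hd, coeff_one, coeff_X, pow_succ]

/-- There are `(m + 1).choose 2` unordered biletters, of which `m` are diagonal. -/
theorem prod_contentSeries (m : ℕ) :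
    ∏ e : Sym2 (Fin m), contentSeries e = invOneAddSqPow ((m + 1).choose 2) * (1 + X) ^ m := by
  have h1 : (1 + X ^ 2 : PowerSeries ℤ) ^ ((m + 1).choose 2) *
      ∏ e : Sym2 (Fin m), contentSeries e = (1 + X) ^ m := by
    have hcard : (m + 1).choose 2 = #(univ : Finset (Sym2 (Fin m))) := by
      rw [card_univ, Sym2.card, Fintype.card_fin]
    have hdiag : #{e : Sym2 (Fin m) | e.IsDiag} = m := by
      rw [← Fintype.card_subtype, Sym2.card_subtype_diag, Fintype.card_fin]
    rw [hcard, ← prod_const, ← prod_mul_distrib]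
    simp only [one_add_sq_mul_contentSeries]
    rw [prod_ite, prod_const, prod_const_one, mul_one, hdiag]
  rw [← h1, ← mul_assoc, mul_comm (invOneAddSqPow _), one_add_sq_pow_mul_invOneAddSqPow, one_mul]

theorem coeff_one_add_X_pow (m k : ℕ) :
    coeff k ((1 + X : PowerSeries ℤ) ^ m) = (m.choose k : ℤ) := by
  have : (1 + X : PowerSeries ℤ) ^ m = (((1 + Polynomial.X) ^ m : Polynomial ℤ) : PowerSeries ℤ) := by
    simp
  rw [this, Polynomial.coeff_coe, Polynomial.coeff_one_add_X_pow]

theorem aHat_eq_sum_choose (n m : ℕ) :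
    aHat n m = ∑ j ∈ range (n / 2 + 1),
      (-1 : ℤ) ^ j * (((m + 1).choose 2 + j - 1).choose j : ℤ) * (m.choose (n - 2 * j) : ℤ) := by
  rw [aHat_eq_coeff, prod_contentSeries, coeff_mul,
    Finset.Nat.sum_antidiagonal_eq_sum_range_succ_mk]
  symm
  refine Finset.sum_of_injOn (fun j => 2 * j) ?_ ?_ ?_ ?_
  · intro a _ b _ h
    simpa using h
  · intro j hj
    simp only [coe_range, Set.mem_Iio] at hj ⊢
    omega
  · intro d hd hnot
    have hodd : ¬ Even d := fun ⟨j, hj⟩ => hnot ⟨j, by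
      simp only [coe_range, Set.mem_Iio, mem_range] at hd ⊢
      exact ⟨by omega, by omega⟩⟩
    simp [invOneAddSqPow, hodd]
  -- Truncated subtraction agrees with the convention for the binomial of -1 over 0: at `m = 0`, `j
  -- = 0` the factor is `Nat.choose 0 0 = 1`.
  · intro j _
    simp [invOneAddSqPow, coeff_one_add_X_pow, Nat.multichoose_eq]

end SignedEulerian

theorem mainTheorem2 (n s : ℕ) (hns : n ≠ 0 ∨ s ≠ 0) :
    (∑ j ∈ Finset.range s, ((n + j).choose j : ℤ) * SignedEulerian.f n (s - j - 1) =
      ∑ j ∈ Finset.range (n / 2 + 1),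
        (-1 : ℤ) ^ j * (((s + 1).choose 2 + j - 1).choose j : ℤ) * (s.choose (n - 2 * j) : ℤ)) ∧
    (∑ j ∈ Finset.range s, ((n + j).choose j : ℤ) * SignedEulerian.f n (s - j - 1) =
      SignedEulerian.aHat n s) ∧
    (∑ j ∈ Finset.range s, ((n + j).choose j : ℤ) * SignedEulerian.f n (s - j - 1) =
      ∑ σ ∈ SignedEulerian.involutions n,
        ((Equiv.Perm.sign σ : ℤˣ) : ℤ) * ((SignedEulerian.Gen s σ).card : ℤ)) ∧
    (∀ σ ∈ SignedEulerian.involutions n,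
      (∀ j < s, SignedEulerian.ris σ = s - j - 1 →
        (SignedEulerian.Gen s σ).card = (n + j).choose j) ∧
      (s ≤ SignedEulerian.ris σ → (SignedEulerian.Gen s σ).card = 0)) := by
  have h1 := SignedEulerian.sum_choose_mul_f_eq hns
  have h2 := h1.trans (SignedEulerian.sum_sign_mul_card_Gen n s)
  refine ⟨h2.trans (SignedEulerian.aHat_eq_sum_choose n s), h2, h1, fun σ hσ => ?_⟩
  have hσ' : σ * σ = 1 := by simpa [SignedEulerian.involutions] using hσ
  exact ⟨fun j hj hr => SignedEulerian.card_Gen_of_ris_eq hσ' hj hr,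
    SignedEulerian.card_Gen_of_le_ris hσ' hns⟩
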